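/- Let $m,n\ge 1$ and let $\mathbb{R}^{[k,n]}$ denote the space of real tensors of order $k$ and dimension $n$, with entries indexed by $(i_1,\dots,i_k)\in[n]^k$, where $[n]=\{1,\dots,n\}$; for a tensor, $\ge 0$ means that all its entries are nonnegative. For $\mathcal{M}\in\mathbb{R}^{[2m,n]}$ and $\mathcal{Z}\in\mathbb{R}^{[m,n]}$ let $\mathcal{M}\mathcal{Z}\in\mathbb{R}^{[m,n]}$ be the tensor $$(\mathcal{M}\mathcal{Z})_{i_1\dots i_m}=\sum_{j_1,\dots,j_m=1}^n m_{i_1\dots i_m j_1\dots j_m}\,z_{j_1\dots j_m},$$ and let $\langle\mathcal{X},\mathcal{Y}\rangle=\sum_{i_1,\dots,i_m=1}^n x_{i_1\dots i_m}y_{i_1\dots i_m}$ for $\mathcal{X},\mathcal{Y}\in\mathbb{R}^{[m,n]}$. The tensor $\mathcal{M}$ is block symmetric if $m_{i_1\dots i_m j_1\dots j_m}=m_{j_1\dots j_m i_1\dots i_m}$ for all indices. It is $T$-column sufficient if every $\mathcal{Z}\in\mathbb{R}^{[m,n]}$ with $z_{i_1\dots i_m}(\mathcal{M}\mathcal{Z})_{i_1\dots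 i_m}\le 0$ for all $i_1,\dots,i_m\in[n]$ satisfies $z_{i_1\dots i_m}(\mathcal{M}\mathcal{Z})_{i_1\dots i_m}=0$ for all $i_1,\dots,i_m\in[n]$. For $\mathcal{Q}\in\mathbb{R}^{[m,n]}$, the problem $\mathrm{TLCP}(\mathcal{M},\mathcal{Q})$ is to find $\mathcal{Z}\in\mathbb{R}^{[m,n]}$ with $$\mathcal{Z}\ge 0,\qquad \mathcal{M}\mathcal{Z}+\mathcal{Q}\ge 0,\qquad \langle\mathcal{Z},\mathcal{M}\mathcal{Z}+\mathcal{Q}\rangle=0;$$ it is feasible if some $\mathcal{Z}\in\mathbb{R}^{[m,n]}$ satisfies the first two conditions, and solvable if some $\mathcal{Z}\in\mathbb{R}^{[m,n]}$ satisfies all three. **Theorem.** Let $\mathcal{M}\in\mathbb{R}^{[2m,n]}$ be block symmetric and $T$-column sufficient, and let $\mathcal{Q}\in\mathbb{R}^{[m,n]}$. If $\mathrm{TLCP}(\mathcal{M},\mathcal{Q})$ is feasible, then it is solvable. -/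

import Mathlib

namespace TensorLCP

/-- Real tensors of order `k` and dimension `n`: an entry is indexed by `(i₁, …, iₖ)` with each
`iⱼ` in an `n`-element set. Order, addition and scalar multiplication are entrywise. -/
abbrev Tensor (k n : ℕ) : Type := (Fin k → Fin n) → ℝ

/-- The index `(i₁, …, iₘ, j₁, …, jₘ)` of length `2m` made of the two blocks `i` and `j`. -/
def blockIndex {m n : ℕ} (i j : Fin m → Fin n) : Fin (2 * m) → Fin n :=
  fun t => Fin.append i j (Fin.cast (two_mul m) t)

/-- The contraction product `M Z`, over the last `m` indices of `M`. -/
def contract {m n : ℕ} (M : Tensor (2 * m) n) (Z : Tensor m n) : Tensor m n :=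
  fun i => ∑ j : Fin m → Fin n, M (blockIndex i j) * Z j

/-- The inner product of two tensors of the same order and dimension. -/
def tensorInner {m n : ℕ} (X Y : Tensor m n) : ℝ :=
  ∑ i : Fin m → Fin n, X i * Y i

/-- Block symmetry: exchanging the first and the last `m` indices does not change the entry. -/
def IsBlockSymmetric {m n : ℕ} (M : Tensor (2 * m) n) : Prop :=
  ∀ i j : Fin m → Fin n, M (blockIndex i j) = M (blockIndex j i)

/-- `T`-column sufficiency. -/
def IsTColumnSufficient {m n : ℕ} (M : Tensor (2 * m) n) : Prop :=
  ∀ Z : Tensor m n, (∀ i, Z i * contract M Z i ≤ 0) → ∀ i, Z i * contract M Z i = 0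

/-- Feasibility of the linear complementarity problem given by `M` and `Q`. -/
def IsFeasible {m n : ℕ} (M : Tensor (2 * m) n) (Q : Tensor m n) : Prop :=
  ∃ Z : Tensor m n, 0 ≤ Z ∧ 0 ≤ contract M Z + Q

/-- The solution set of the linear complementarity problem given by `M` and `Q`. -/
def solutionSet {m n : ℕ} (M : Tensor (2 * m) n) (Q : Tensor m n) : Set (Tensor m n) :=
  {Z | 0 ≤ Z ∧ 0 ≤ contract M Z + Q ∧ tensorInner Z (contract M Z + Q) = 0}

/-- The problem is solvable when it has at least one solution. -/
def IsSolvable {m n : ℕ} (M : Tensor (2 * m) n) (Q : Tensor m n) : Prop :=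
  (solutionSet M Q).Nonempty

end TensorLCP

open Matrix Filter Topology

namespace TensorLCP

section Quadratic

variable {ι : Type*} [Fintype ι]

/-! With index blocks flattened, `M` is a symmetric matrix `A`, and sufficiency makes it positive
semidefinite. The complementarity problem is then the first-order condition for minimizing `z ⬝ᵥ A
*ᵥ z / 2 + q ⬝ᵥ z` over the nonnegative orthant, so only attainment is at stake
(`exists_minimizer`). Take minimizers on growing boxes, each of least coordinate sum. If the sums
tend to infinity, the normalized minimizers accumulate at a direction `d` along which, by
feasibility, the quadratic is constant; subtracting `d` contradicts least sum. Otherwise infinitely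
many of them lie in one fixed box, whose own minimizer is global. -/

/-- A symmetric column sufficient matrix is positive semidefinite. -/
theorem posSemidef_of_columnSufficient {A : Matrix ι ι ℝ} (hA : A.IsHermitian)
    (hcs : ∀ z : ι → ℝ, (∀ i, z i * (A *ᵥ z) i ≤ 0) → ∀ i, z i * (A *ᵥ z) i = 0) :
    A.PosSemidef := by
  classical
  rw [hA.posSemidef_iff_eigenvalues_nonneg]
  intro k
  by_contra hk
  replace hk : hA.eigenvalues k < 0 := not_le.mp hk
  have hv (i : ι) : hA.eigenvectorBasis k i * (A *ᵥ ⇑(hA.eigenvectorBasis k)) i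
      = hA.eigenvalues k * hA.eigenvectorBasis k i ^ 2 := by
    rw [hA.mulVec_eigenvectorBasis]
    simp only [Pi.smul_apply, smul_eq_mul]
    ring
  -- On an eigenvector with negative eigenvalue `λ`, each product is `λ * z i ^ 2 ≤ 0`, so
  -- sufficiency forces the vector to vanish.
  have hzero := hcs (hA.eigenvectorBasis k) fun i => by
    rw [hv]
    exact mul_nonpos_of_nonpos_of_nonneg hk.le (sq_nonneg _)
  have hvec : hA.eigenvectorBasis k = 0 := by
    ext i
    have := hzero i
    rw [hv] at this
    simpa [hk.ne] using this
  have hnorm := hA.eigenvectorBasis.orthonormal.1 k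
  simp [hvec] at hnorm

/-- The quadratic function whose gradient at `z` is `A z + q`, for symmetric `A`. -/
noncomputable def quadratic (A : Matrix ι ι ℝ) (q z : ι → ℝ) : ℝ :=
  z ⬝ᵥ A *ᵥ z / 2 + q ⬝ᵥ z

theorem continuous_quadratic (A : Matrix ι ι ℝ) (q : ι → ℝ) : Continuous (quadratic A q) := by
  unfold quadratic
  fun_prop

theorem dotProduct_mulVec_symm {A : Matrix ι ι ℝ} (hA : A.IsHermitian) (x y : ι → ℝ) :
    x ⬝ᵥ A *ᵥ y = y ⬝ᵥ A *ᵥ x := by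
  rw [dotProduct_mulVec, ← mulVec_transpose, dotProduct_comm]
  congr 2

theorem quadratic_add_smul {A : Matrix ι ι ℝ} (hA : A.IsHermitian) (q z d : ι → ℝ) (t : ℝ) :
    quadratic A q (z + t • d)
      = quadratic A q z + t * (d ⬝ᵥ (A *ᵥ z + q)) + t ^ 2 * (d ⬝ᵥ A *ᵥ d / 2) := by
  simp only [quadratic, mulVec_add, mulVec_smul, dotProduct_add, add_dotProduct, dotProduct_smul,
    smul_dotProduct, smul_eq_mul]
  rw [dotProduct_mulVec_symm hA z d, dotProduct_comm q d]
  ring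

theorem nonneg_of_forall_le_one {a b : ℝ}
    (h : ∀ t : ℝ, 0 < t → t ≤ 1 → 0 ≤ t * a + t ^ 2 * b) : 0 ≤ a := by
  have hlim : Tendsto (fun t : ℝ => a + t * b) (𝓝[>] 0) (𝓝 a) := by
    have : Continuous fun t : ℝ => a + t * b := by fun_prop
    simpa using (this.tendsto 0).mono_left nhdsWithin_le_nhds
  refine ge_of_tendsto hlim ?_
  filter_upwards [Ioc_mem_nhdsGT (zero_lt_one' ℝ)] with t ht
  refine nonneg_of_mul_nonneg_right (a := t) ?_ ht.1
  linarith [h t ht.1 ht.2]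

/-- First-order optimality along a feasible direction. -/
theorem directional_nonneg_of_minimizer {A : Matrix ι ι ℝ} (hA : A.IsHermitian)
    {q z d : ι → ℝ} (hmin : ∀ y : ι → ℝ, 0 ≤ y → quadratic A q z ≤ quadratic A q y)
    (hd : ∀ t : ℝ, 0 < t → t ≤ 1 → 0 ≤ z + t • d) : 0 ≤ d ⬝ᵥ (A *ᵥ z + q) := by
  refine nonneg_of_forall_le_one (b := d ⬝ᵥ A *ᵥ d / 2) fun t h0 h1 => ?_
  have := hmin _ (hd t h0 h1)
  rw [quadratic_add_smul hA] at this
  linarith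

/-- A minimizer of the quadratic over the nonnegative orthant solves the complementarity
problem. -/
theorem complementarity_of_minimizer {A : Matrix ι ι ℝ} (hA : A.IsHermitian) {q z : ι → ℝ}
    (hz : 0 ≤ z) (hmin : ∀ y : ι → ℝ, 0 ≤ y → quadratic A q z ≤ quadratic A q y) :
    0 ≤ A *ᵥ z + q ∧ z ⬝ᵥ (A *ᵥ z + q) = 0 := by
  classical
  constructor
  · intro i
    have := directional_nonneg_of_minimizer hA (d := Pi.single i 1) hmin fun t h0 _ =>
      add_nonneg hz (smul_nonneg h0.le (Pi.single_nonneg.mpr zero_le_one))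
    simpa using this
  · have h1 := directional_nonneg_of_minimizer hA (d := z) hmin fun t h0 _ =>
      add_nonneg hz (smul_nonneg h0.le hz)
    -- `z - t • z` stays in the orthant because `t ≤ 1`; the directions `z` and `-z` together give
    -- equality.
    have h2 := directional_nonneg_of_minimizer hA (d := -z) hmin fun t h0 ht i => by
      have := mul_nonneg (sub_nonneg.mpr ht) (hz i)
      simp only [Pi.zero_apply, Pi.add_apply, Pi.smul_apply, Pi.neg_apply, smul_eq_mul] at this ⊢
      linarith
    rw [neg_dotProduct] at h2
    linarith

/-- On a box, there is a minimizer of the quadratic with least coordinate sum. -/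
theorem exists_minimizer_box (A : Matrix ι ι ℝ) (q : ι → ℝ) (k : ℕ) :
    ∃ z ∈ Set.Icc (0 : ι → ℝ) (fun _ => (k : ℝ)),
      (∀ y ∈ Set.Icc (0 : ι → ℝ) (fun _ => (k : ℝ)), quadratic A q z ≤ quadratic A q y) ∧
      ∀ y ∈ Set.Icc (0 : ι → ℝ) (fun _ => (k : ℝ)),
        quadratic A q y ≤ quadratic A q z → ∑ i, z i ≤ ∑ i, y i := by
  have hf := continuous_quadratic A q
  obtain ⟨x, hx, hxmin⟩ := (isCompact_Icc (a := (0 : ι → ℝ)) (b := fun _ => (k : ℝ))).exists_isMinOn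
    ⟨0, le_rfl, fun _ => k.cast_nonneg⟩ hf.continuousOn
  obtain ⟨z, ⟨hz, hzx⟩, hzmin⟩ :=
    ((isCompact_Icc (a := (0 : ι → ℝ)) (b := fun _ => (k : ℝ))).inter_right
      (isClosed_le hf (continuous_const (y := quadratic A q x)))).exists_isMinOn
    ⟨x, hx, le_refl (quadratic A q x)⟩
    (f := fun y => ∑ i, y i) (by fun_prop)
  exact ⟨z, hz, fun y hy => le_trans hzx (hxmin hy),
    fun y hy hyz => hzmin ⟨hy, le_trans hyz hzx⟩⟩

/-- A nonnegative direction along which the quadratic does not increase at infinity is a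
direction in which it is constant, as soon as the complementarity problem is feasible. -/
theorem quadratic_sub_eq {A : Matrix ι ι ℝ} (hA : A.PosSemidef) {q z₀ d : ι → ℝ}
    (hz₀ : 0 ≤ A *ᵥ z₀ + q) (hd : 0 ≤ d) (hAd : d ⬝ᵥ A *ᵥ d ≤ 0)
    (hqd : q ⬝ᵥ d ≤ 0) (z : ι → ℝ) : quadratic A q (z - d) = quadratic A q z := by
  have hdd : d ⬝ᵥ A *ᵥ d = 0 :=
    le_antisymm hAd (by simpa using hA.dotProduct_mulVec_nonneg d)
  have hzero : A *ᵥ d = 0 := (hA.dotProduct_mulVec_zero_iff d).mp (by simpa using hdd)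
  have hmul (x : ι → ℝ) : d ⬝ᵥ A *ᵥ x = 0 := by
    rw [dotProduct_mulVec_symm hA.isHermitian, hzero, dotProduct_zero]
  -- Feasibility enters here: since `A *ᵥ d = 0`, this pairing is just `d ⬝ᵥ q`.
  have hge : 0 ≤ d ⬝ᵥ (A *ᵥ z₀ + q) := dotProduct_nonneg_of_nonneg hd hz₀
  rw [dotProduct_add, hmul, zero_add] at hge
  have hq : d ⬝ᵥ q = 0 := le_antisymm (by rwa [dotProduct_comm]) hge
  have := quadratic_add_smul hA.isHermitian q z d (-1)
  rw [dotProduct_add, hmul, hmul, hq] at this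
  rw [sub_eq_add_neg, ← neg_one_smul ℝ d, this]
  ring

/-- A sequence of nonnegative vectors with coordinate sums tending to infinity on which the
quadratic is nonpositive has an asymptotic direction along which the quadratic does not
increase. -/
theorem exists_asymptotic_direction {A : Matrix ι ι ℝ} (hA : A.PosSemidef) {q : ι → ℝ}
    {z : ℕ → ι → ℝ} (hz : ∀ k, 0 ≤ z k) (hle : ∀ k, quadratic A q (z k) ≤ 0)
    (hs : Tendsto (fun k => ∑ i, z k i) atTop atTop) :
    ∃ d : ι → ℝ, 0 ≤ d ∧ ∑ i, d i = 1 ∧ d ⬝ᵥ A *ᵥ d ≤ 0 ∧ q ⬝ᵥ d ≤ 0 ∧ ∃ k, d ≤ z k := by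
  set s : ℕ → ℝ := fun k => ∑ i, z k i with hsdef
  obtain ⟨N, hN⟩ := eventually_atTop.mp (hs.eventually_gt_atTop 0)
  set y : ℕ → ι → ℝ := fun k => (s (k + N))⁻¹ • z (k + N) with hy
  have hspos (k : ℕ) : 0 < s (k + N) := hN _ (Nat.le_add_left _ _)
  have hzy (k : ℕ) : z (k + N) = s (k + N) • y k := by
    simp [hy, smul_smul, (hspos k).ne']
  have hmem (k : ℕ) : y k ∈ stdSimplex ℝ ι := by
    refine ⟨fun i => mul_nonneg (inv_nonneg.mpr (hspos k).le) (hz _ i), ?_⟩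
    simp only [hy, Pi.smul_apply, smul_eq_mul, ← Finset.mul_sum]
    exact inv_mul_cancel₀ (hspos k).ne'
  obtain ⟨d, ⟨hd0, hd1⟩, φ, hφ, hlim⟩ := (isCompact_stdSimplex ℝ ι).tendsto_subseq hmem
  have hsφ : Tendsto (fun k => s (φ k + N)) atTop atTop :=
    hs.comp ((tendsto_add_atTop_nat N).comp hφ.tendsto_atTop)
  have hAlim : Tendsto (fun k => y (φ k) ⬝ᵥ A *ᵥ y (φ k)) atTop (𝓝 (d ⬝ᵥ A *ᵥ d)) := by
    have hc : Continuous fun x : ι → ℝ => x ⬝ᵥ A *ᵥ x := by fun_prop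
    exact (hc.tendsto d).comp hlim
  have hqlim : Tendsto (fun k => q ⬝ᵥ y (φ k)) atTop (𝓝 (q ⬝ᵥ d)) := by
    have hc : Continuous fun x : ι → ℝ => q ⬝ᵥ x := by fun_prop
    exact (hc.tendsto d).comp hlim
  have hbound (k : ℕ) : y k ⬝ᵥ A *ᵥ y k * s (k + N) / 2 + q ⬝ᵥ y k ≤ 0 := by
    have h := hle (k + N)
    rw [hzy] at h
    simp only [quadratic, mulVec_smul, dotProduct_smul, smul_dotProduct, smul_eq_mul] at h
    refine nonpos_of_mul_nonpos_right (a := s (k + N)) ?_ (hspos k)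
    linarith
  have hpsd (k : ℕ) : 0 ≤ y k ⬝ᵥ A *ᵥ y k := by simpa using hA.dotProduct_mulVec_nonneg (y k)
  refine ⟨d, hd0, hd1, ?_, ?_, ?_⟩
  -- Dividing `hbound` by the sum leaves the quadratic term below a quantity that tends to zero.
  · have hr : Tendsto (fun k => -(q ⬝ᵥ y (φ k)) * 2 / s (φ k + N)) atTop (𝓝 0) :=
      (hqlim.neg.mul_const 2).div_atTop hsφ
    refine le_of_tendsto_of_tendsto' hAlim hr fun k => ?_
    rw [le_div_iff₀ (hspos _)]
    linarith [hbound (φ k)]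
  · refine le_of_tendsto' hqlim fun k => ?_
    have := mul_nonneg (hpsd (φ k)) (hspos (φ k)).le
    linarith [hbound (φ k)]
  -- Coordinates in the support of `d` tend to infinity; elsewhere nonnegativity suffices.
  · have hev : ∀ᶠ k in atTop, ∀ i, d i ≤ z (φ k + N) i := by
      rw [eventually_all]
      intro i
      rcases (hd0 i).eq_or_lt with hi | hi
      · exact Eventually.of_forall fun k => hi ▸ hz _ i
      · have hi' : Tendsto (fun k => z (φ k + N) i) atTop atTop := by
          simp only [hzy, Pi.smul_apply, smul_eq_mul]
          exact hsφ.atTop_mul_pos hi ((tendsto_pi_nhds.mp hlim) i)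
        exact hi'.eventually_ge_atTop _
    obtain ⟨k, hk⟩ := hev.exists
    exact ⟨_, hk⟩

/-- A convex quadratic attains its minimum on the nonnegative orthant if the associated
complementarity problem is feasible. -/
theorem exists_minimizer {A : Matrix ι ι ℝ} (hA : A.PosSemidef) {q z₀ : ι → ℝ}
    (hz₀ : 0 ≤ A *ᵥ z₀ + q) :
    ∃ z : ι → ℝ, 0 ≤ z ∧ ∀ y : ι → ℝ, 0 ≤ y → quadratic A q z ≤ quadratic A q y := by
  choose z hz hmin hsum using exists_minimizer_box A q
  by_cases hs : Tendsto (fun k => ∑ i, z k i) atTop atTop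
  · exfalso
    have hle (k : ℕ) : quadratic A q (z k) ≤ 0 := by
      simpa [quadratic] using hmin k 0 ⟨le_rfl, fun _ => k.cast_nonneg⟩
    obtain ⟨d, hd0, hd1, hAd, hqd, k, hk⟩ :=
      exists_asymptotic_direction hA (fun k => (hz k).1) hle hs
    -- `z k - d` stays in the box with the same value, but its sum is smaller by one.
    have hlt := hsum k (z k - d) ⟨sub_nonneg.mpr hk, (sub_le_self _ hd0).trans (hz k).2⟩
      (quadratic_sub_eq hA hz₀ hd0 hAd hqd _).le
    simp only [Pi.sub_apply, Finset.sum_sub_distrib, hd1] at hlt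
    linarith
  · obtain ⟨B, hB⟩ := by simpa only [tendsto_atTop, not_forall] using hs
    rw [not_eventually] at hB
    have hmemB (k : ℕ) (hk : ∑ i, z k i ≤ B) : z k ∈ Set.Icc (0 : ι → ℝ) (fun _ => B) :=
      ⟨(hz k).1, fun i =>
        (Finset.single_le_sum (fun j _ => (hz k).1 j) (Finset.mem_univ i)).trans hk⟩
    obtain ⟨k₀, hk₀⟩ := hB.exists
    obtain ⟨x, hx, hxmin⟩ := (isCompact_Icc (a := (0 : ι → ℝ)) (b := fun _ => B)).exists_isMinOn
      ⟨_, hmemB k₀ (not_le.mp hk₀).le⟩ (continuous_quadratic A q).continuousOn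
    refine ⟨x, hx.1, fun y hy => ?_⟩
    -- Some box contains `y` and also has its minimizer in the box of side `B`.
    have hev : ∀ᶠ k : ℕ in atTop, ∀ i, y i ≤ k :=
      eventually_all.mpr fun i => tendsto_natCast_atTop_atTop.eventually_ge_atTop (y i)
    obtain ⟨k, hk, hyk⟩ := (hB.and_eventually hev).exists
    exact (hxmin (hmemB k (not_le.mp hk).le)).trans (hmin k y ⟨hy, hyk⟩)

end Quadratic

/-- The matrix of the linear map given by contraction with a tensor of even order. -/
def blockMatrix {m n : ℕ} (M : Tensor (2 * m) n) :
    Matrix (Fin m → Fin n) (Fin m → Fin n) ℝ :=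
  Matrix.of fun i j => M (blockIndex i j)

theorem blockMatrix_mulVec {m n : ℕ} (M : Tensor (2 * m) n) (Z : Tensor m n) :
    blockMatrix M *ᵥ Z = contract M Z :=
  rfl

theorem IsBlockSymmetric.isHermitian {m n : ℕ} {M : Tensor (2 * m) n}
    (h : IsBlockSymmetric M) : (blockMatrix M).IsHermitian :=
  Matrix.IsHermitian.ext fun i j => h j i

end TensorLCP

theorem theorem4p2 (m n : ℕ) (M : TensorLCP.Tensor (2 * m) n) (Q : TensorLCP.Tensor m n)
    (hsymm : TensorLCP.IsBlockSymmetric M) (hcs : TensorLCP.IsTColumnSufficient M)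
    (hfeas : TensorLCP.IsFeasible M Q) : TensorLCP.IsSolvable M Q := by
  obtain ⟨Z₀, -, hZ₀⟩ := hfeas
  have hherm := hsymm.isHermitian
  obtain ⟨Z, hZ, hmin⟩ :=
    TensorLCP.exists_minimizer (TensorLCP.posSemidef_of_columnSufficient hherm hcs) hZ₀
  exact ⟨Z, hZ, TensorLCP.complementarity_of_minimizer hherm hZ hmin⟩
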